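/- The following decision problem is undecidable: given a context-free grammar $G$, does $G$ generate a square, i.e., does $L(G)$ contain a word of the form $xx$ with $x$ a non-empty word? That is, no algorithm, given as input a finite description of an arbitrary context-free grammar $G$ (its start variable and its finite list of productions, over finite sets of terminal letters and variables of arbitrary size that are part of the input), always halts and answers correctly whether $L(G)$ contains a square. -/

import Mathlib

/-- A symbol of a grammar description: `Sum.inl a` is the terminal letter with name `a`,
`Sum.inr A` is the variable (nonterminal) with name `A`. -/
abbrev SymbolCode : Type := ℕ ⊕ ℕ

/-- A finite description of a context-free grammar: the name of the start variable together with
the finite list of productions `A → γ`, each given as the pair `(A, γ)`. The letters and the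
variables are named by natural numbers; only finitely many of them occur in one description, and
their number is not bounded in advance. This is a type of finite objects with its standard
(primitive recursive) encoding, so that it can serve as the type of inputs of an algorithm. -/
abbrev CFGCode : Type := ℕ × List (ℕ × List SymbolCode)

/-- The grammar symbol named by a symbol of a description. -/
def SymbolCode.toSymbol : SymbolCode → Symbol ℕ ℕ
  | Sum.inl a => Symbol.terminal a
  | Sum.inr A => Symbol.nonterminal A

/-- The context-free grammar with a given description. -/
def CFGCode.toGrammar (G : CFGCode) : ContextFreeGrammar ℕ where
  NT := ℕ
  initial := G.1
  rules := (G.2.map fun p : ℕ × List SymbolCode =>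
    (⟨p.1, p.2.map SymbolCode.toSymbol⟩ : ContextFreeRule ℕ ℕ)).toFinset

/-- A word is a square if it is of the form `xx` for a nonempty word `x`. -/
def IsSquareWord {α : Type*} (w : List α) : Prop :=
  ∃ x : List α, x ≠ [] ∧ w = x ++ x

/-- The decision problem: the grammar described by `G` generates a square. -/
def GeneratesSquare (G : CFGCode) : Prop :=
  ∃ w ∈ (CFGCode.toGrammar G).language, IsSquareWord w

/-! The halting problem is reduced to the question. There is a fixed Turing machine whose halting on
the inputs `pre ++ List.replicate n x` is undecidable in `n` (`exists_turingMachine`). A finite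
semi-Thue system simulates it, and halting means that the initial word `w₀` can be rewritten to a
word with a factor in a finite set `H` (`eval_dom_iff_semiThue`).

The grammar generates the words `mark x mark w₀ # z`. Here `x` is a concatenation of blocks `C # Dᴿ
$` with `D` obtained from `C` in at most one step, and `z` is a concatenation of blocks `Dᴿ $ D #`
closed by a block `Dᴿ $` whose `D` has a factor in `H`. Both shapes are context-free, since a block
compares only two neighbouring words, one of them reversed. As there are just two marks, a square
forces `x = w₀ # z`. Read as `x`, this word says that each `D` follows from its `C`; read as `w₀ #
z`, it says that the first `C` is `w₀`, that each `D` is the next `C`, and that the last `D` is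
halting. So a square is exactly a halting run (`exists_yields_square_iff`).

Only one production mentions `w₀`, so the grammar is computable from `n`
(`exists_computable_generatesSquare`). -/

/-! ### A Turing machine with undecidable halting on unary inputs -/

open Turing in
theorem trNat_two_pow (n : ℕ) :
    PartrecToTM2.trNat (2 ^ n) =
      List.replicate n PartrecToTM2.Γ'.bit0 ++ [PartrecToTM2.Γ'.bit1] := by
  have key : ∀ n : ℕ, ∃ p : PosNum, ((2 ^ n : ℕ) : Num) = Num.pos p ∧
      PartrecToTM2.trPosNum p =
        List.replicate n PartrecToTM2.Γ'.bit0 ++ [PartrecToTM2.Γ'.bit1] := by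
    intro n
    induction n with
    | zero => exact ⟨PosNum.one, by simp; rfl, rfl⟩
    | succ n ih =>
      obtain ⟨p, hp, h⟩ := ih
      refine ⟨PosNum.bit0 p, ?_, ?_⟩
      · have h2 : ((2 ^ (n + 1) : ℕ) : Num) = Num.pos p + Num.pos p := by
          rw [← hp, pow_succ, mul_two, Nat.cast_add]
        rw [h2]
        exact Num.bit0_of_bit0 (Num.pos p)
      · simp [PartrecToTM2.trPosNum, h, List.replicate_succ]
  obtain ⟨p, hp, h⟩ := key n
  rw [PartrecToTM2.trNat, hp]
  exact h

open Nat.Partrec (Code) in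
theorem not_computablePred_halts_nat :
    ¬ ComputablePred fun n : ℕ => (Code.eval (Denumerable.ofNat Code n) 0).Dom := by
  intro h
  refine ComputablePred.halting_problem 0 ?_
  refine ComputablePred.computable_of_manyOneReducible
    (q := fun n : ℕ => (Code.eval (Denumerable.ofNat Code n) 0).Dom)
    ⟨Encodable.encode, Computable.encode, fun c => ?_⟩ h
  simp

open Nat.Partrec (Code) in
-- On input `m`, search for `n` with `2 ^ n = m`, then run the `n`-th code on `0`. Powers of two are
-- used because their binary expansion is a single letter repeated `n` times up to a fixed end,
-- which keeps the input word simple as a function of `n`.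
theorem exists_partrec_two_pow :
    ∃ f : ℕ →. ℕ, Partrec f ∧ ¬ ComputablePred fun n : ℕ => (f (2 ^ n)).Dom := by
  have hpow : Primrec fun n : ℕ => 2 ^ n :=
    (Primrec.nat_rec₁ 1 (Primrec.nat_mul.comp Primrec.snd (Primrec.const 2)).to₂).of_eq fun n => by
      induction n with
      | zero => rfl
      | succ n ih => simp only [pow_succ, ← ih]
  have hc : Computable₂ fun m n : ℕ => decide (2 ^ n = m) :=
    (Primrec.eq.decide.comp (hpow.comp Primrec.snd) Primrec.fst).to_comp.to₂
  have h1 : Partrec fun m : ℕ => Nat.rfind fun n => Part.some (decide (2 ^ n = m)) :=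
    Partrec.rfind hc.partrec₂
  have h2 : Partrec fun n : ℕ => Code.eval (Denumerable.ofNat Code n) 0 :=
    Nat.Partrec.Code.eval_part.comp (Computable.ofNat Code) (Computable.const 0)
  refine ⟨_, h1.bind (h2.comp Computable.snd).to₂, ?_⟩
  convert not_computablePred_halts_nat using 3 with n
  have h3 : (Nat.rfind fun k => Part.some (decide (2 ^ k = 2 ^ n))) = Part.some n := by
    refine Part.eq_some_iff.2 (Nat.mem_rfind.2 ⟨by simp, fun {m} hm => ?_⟩)
    simp [hm.ne]
  simp only [Part.bind_dom]
  constructor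
  · rintro ⟨h, h'⟩
    simpa only [h3, Part.get_some] using h'
  · intro h
    exact ⟨by rw [h3]; trivial, by simpa only [h3, Part.get_some] using h⟩

open Turing in
theorem TM2to1.eval_tr_tr_dom {K : Type*} [DecidableEq K] {Γ : K → Type*} {Λ σ : Type*}
    [Inhabited Λ] [Inhabited σ] (M : Λ → TM2.Stmt Γ Λ σ) (k : K) (L : List (Γ k)) :
    (TM0.eval (TM1to0.tr (TM2to1.tr M)) (TM2to1.trInit k L)).Dom ↔ (TM2.eval M k L).Dom := by
  rw [TM1to0.tr_eval, TM2to1.tr_eval_dom]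

open Turing in
theorem TM2to1.trInit_of_reverse_eq_cons {K : Type*} [DecidableEq K] {Γ : K → Type*} {k : K}
    {L l : List (Γ k)} {a : Γ k} (h : L.reverse = a :: l) :
    TM2to1.trInit k L = (true, Function.update (fun _ => none) k (some a)) ::
      l.map fun b => (false, Function.update (fun _ => none) k (some b)) := by
  simp only [TM2to1.trInit, h]
  rfl

open Turing in
theorem PartrecToTM2.eval_tr_dom (c : ToPartrec.Code) (v : List ℕ) :
    (@TM2.eval PartrecToTM2.K' (fun _ => PartrecToTM2.Γ') PartrecToTM2.Λ' (Option PartrecToTM2.Γ')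
      ⟨PartrecToTM2.trNormal c PartrecToTM2.Cont'.halt⟩ _ _ PartrecToTM2.tr
      PartrecToTM2.K'.main (PartrecToTM2.trList v)).Dom ↔ (c.eval v).Dom := by
  let i1 : Inhabited PartrecToTM2.Λ' := ⟨PartrecToTM2.trNormal c PartrecToTM2.Cont'.halt⟩
  have h1 : TM2.init PartrecToTM2.K'.main (PartrecToTM2.trList v) = PartrecToTM2.init c v := by
    simp only [PartrecToTM2.init, TM2.init]
    congr 1
    funext k
    cases k <;> rfl
  have h2 := congrArg Part.Dom (PartrecToTM2.tr_eval c v)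
  simp only [TM2.eval, Part.map_Dom]
  rw [h1]
  exact Iff.of_eq h2

open Turing in
theorem exists_turingMachine :
    ∃ (Γ Λ : Type) (_ : Inhabited Γ) (_ : Inhabited Λ) (_ : Finite Γ) (M : TM0.Machine Γ Λ)
      (S : Set Λ) (_ : S.Finite) (_ : TM0.Supports M S) (pre : List Γ) (x : Γ),
      ¬ ComputablePred fun n : ℕ => (TM0.eval M (pre ++ List.replicate n x)).Dom := by
  obtain ⟨f, hf, hnc⟩ := exists_partrec_two_pow
  obtain ⟨c, hc⟩ := ToPartrec.Code.exists_code (Nat.Partrec'.part_iff₁.2 hf)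
  -- The default label is the start state of the machine, so this instance makes it start with the
  -- code `c`.
  let i1 : Inhabited PartrecToTM2.Λ' := ⟨PartrecToTM2.trNormal c PartrecToTM2.Cont'.halt⟩
  have hs2 := PartrecToTM2.tr_supports c PartrecToTM2.Cont'.halt
  have hs1 := TM2to1.tr_supports _ hs2
  have hs0 := TM1to0.tr_supports _ hs1
  have : Finite PartrecToTM2.K' :=
    Set.finite_univ_iff.1 ((Set.toFinite {.main, .rev, .aux, .stack}).subset
      fun k _ => by cases k <;> simp)
  let := Fintype.ofFinite PartrecToTM2.K'
  have : Finite (TM2to1.Γ' PartrecToTM2.K' fun _ => PartrecToTM2.Γ') :=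
    @Finite.of_fintype _ (TM2to1.Γ'.fintype)
  let φ : PartrecToTM2.Γ' → TM2to1.Γ' PartrecToTM2.K' fun _ => PartrecToTM2.Γ' := fun a =>
    (false, Function.update (fun _ => none) PartrecToTM2.K'.main (some a))
  -- The stack is laid out from its bottom, so the separator `cons` comes first, with the flag
  -- `true` for the bottom cell, then the leading bit, then the `n` zeros.
  refine ⟨_, _, inferInstance, inferInstance, this, TM1to0.tr (TM2to1.tr PartrecToTM2.tr), _,
    Finset.finite_toSet _, hs0, [(true, (φ .cons).2), φ .bit1], φ .bit0, ?_⟩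
  have key : ∀ n, (TM0.eval (TM1to0.tr (TM2to1.tr PartrecToTM2.tr))
      (([(true, (φ .cons).2), φ .bit1] :
        List (TM2to1.Γ' PartrecToTM2.K' fun _ => PartrecToTM2.Γ')) ++
          List.replicate n (φ .bit0))).Dom ↔ (f (2 ^ n)).Dom := by
    intro n
    have h1 : ([(true, (φ .cons).2), φ .bit1] :
        List (TM2to1.Γ' PartrecToTM2.K' fun _ => PartrecToTM2.Γ')) ++
          List.replicate n (φ .bit0) =
        TM2to1.trInit (Γ := fun _ => PartrecToTM2.Γ') PartrecToTM2.K'.main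
          (PartrecToTM2.trList [2 ^ n]) := by
      have h2 : (PartrecToTM2.trList [2 ^ n]).reverse = PartrecToTM2.Γ'.cons ::
          PartrecToTM2.Γ'.bit1 :: List.replicate n PartrecToTM2.Γ'.bit0 := by
        simp [PartrecToTM2.trList, trNat_two_pow]
      rw [TM2to1.trInit_of_reverse_eq_cons h2]
      exact congrArg (List.cons _) (congrArg (List.cons _) List.map_replicate.symm)
    rw [h1]
    refine (TM2to1.eval_tr_tr_dom _ _ _).trans ((PartrecToTM2.eval_tr_dom c [2 ^ n]).trans ?_)
    rw [show c.eval [2 ^ n] = _ from hc ⟨[2 ^ n], rfl⟩]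
    rfl
  exact fun h => hnc (h.of_eq key)

/-! ### Simulation of the machine by a semi-Thue system -/

/-- One rewriting step of the semi-Thue system with the set of rules `R`. -/
def SemiThueStep {α : Type*} (R : Set (List α × List α)) (u v : List α) : Prop :=
  ∃ p l r s, (l, r) ∈ R ∧ u = p ++ l ++ s ∧ v = p ++ r ++ s

/-- A word with a single letter satisfying `P` splits at that letter in only one way. It serves for
the state letter of a configuration and for the second `mark` of a square. -/
theorem List.append_cons_inj_of_forall_not {α : Type*} {P : α → Prop} {x y x' y' : List α}
    {a a' : α} (hx : ∀ b ∈ x, ¬ P b) (hy : ∀ b ∈ y, ¬ P b) (ha' : P a')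
    (h : x ++ a :: y = x' ++ a' :: y') : x = x' ∧ a = a' ∧ y = y' := by
  induction x generalizing x' with
  | nil =>
    cases x' with
    | nil => simpa using h
    | cons b x' =>
      simp only [List.nil_append, List.cons_append, List.cons.injEq] at h
      exact absurd ha' (hy a' (by simp [h.2]))
  | cons b x ih =>
    cases x' with
    | nil =>
      simp only [List.nil_append, List.cons_append, List.cons.injEq] at h
      exact absurd (h.1 ▸ ha') (hx b (by simp))
    | cons b' x' =>
      simp only [List.cons_append, List.cons.injEq] at h
      obtain ⟨h1, h2⟩ := ih (fun c hc => hx c (by simp [hc])) h.2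
      exact ⟨by rw [h.1, h1], h2⟩

namespace Turing

/-- Letters of the words that encode configurations of a Turing machine with tape alphabet `Γ` and
set of states `Q`: tape symbols, states, and the two end markers. -/
inductive ConfigLetter (Γ Q : Type*)
  | sym (a : Γ)
  | state (q : Q)
  | left
  | right

namespace ConfigLetter

variable {Γ Q : Type*}

instance [Finite Γ] [Finite Q] : Finite (ConfigLetter Γ Q) :=
  Finite.of_surjective
    (fun x : Γ ⊕ Q ⊕ Bool => match x with
      | .inl a => sym a
      | .inr (.inl q) => state q
      | .inr (.inr true) => left
      | .inr (.inr false) => right)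
    fun
      | sym a => ⟨.inl a, rfl⟩
      | state q => ⟨.inr (.inl q), rfl⟩
      | left => ⟨.inr (.inr true), rfl⟩
      | right => ⟨.inr (.inr false), rfl⟩

/-- The letter is a state. -/
def IsState : ConfigLetter Γ Q → Prop
  | state _ => True
  | _ => False

end ConfigLetter

open ConfigLetter

namespace TM0

variable {Γ Λ : Type} {S : Set Λ}

/-- The word that encodes the configuration with state `q`, where `L` is the part of the tape to
the left of the head, read from right to left, and `R` is the rest of the tape. -/
def configWord (L : List Γ) (q : S) (R : List Γ) : List (ConfigLetter Γ S) :=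
  (left :: L.reverse.map sym) ++ state q :: (R.map sym ++ [right])

theorem configWord_split {L R : List Γ} {q q' : S} {p s : List (ConfigLetter Γ S)}
    (h : configWord L q R = p ++ state q' :: s) :
    left :: L.reverse.map sym = p ∧ q = q' ∧ R.map sym ++ [right] = s := by
  have h1 := List.append_cons_inj_of_forall_not (P := IsState) (a := state q) (a' := state q')
    (by simp [IsState]) (by simp [IsState, or_imp, forall_and]) trivial h
  simpa using h1

/-- The configuration encoded by `configWord L q R`. -/
def configOf [Inhabited Γ] (L : List Γ) (q : S) (R : List Γ) : Cfg Γ Λ :=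
  ⟨q, Tape.mk' (ListBlank.mk L) (ListBlank.mk R)⟩

theorem mk_default_nil [Inhabited Γ] : ListBlank.mk [(default : Γ)] = ListBlank.mk [] := by
  have := ListBlank.cons_head_tail (ListBlank.mk ([] : List Γ))
  simpa using this

theorem configOf_nil_right [Inhabited Γ] (L : List Γ) (q : S) :
    configOf L q [default] = configOf L q [] := by
  simp only [configOf, mk_default_nil]

theorem configOf_nil_left [Inhabited Γ] (q : S) (R : List Γ) :
    configOf [default] q R = configOf [] q R := by
  simp only [configOf, mk_default_nil]

variable [Inhabited Λ]

/-- The factors of words that encode halting configurations. -/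
def haltingFactors (M : Machine Γ Λ) (S : Set Λ) : Set (List (ConfigLetter Γ S)) :=
  {h | ∃ (q : S) (a : Γ), M q a = none ∧ h = [state q, sym a]}

theorem haltingFactors_finite [Finite Γ] (M : Machine Γ Λ) (hS : S.Finite) :
    (haltingFactors M S).Finite := by
  have := hS.to_subtype
  refine (Set.finite_range fun x : S × Γ => [state x.1, sym x.2]).subset ?_
  rintro _ ⟨q, a, -, rfl⟩
  exact ⟨(q, a), rfl⟩

variable [Inhabited Γ]

/-- The rules of the semi-Thue system that simulates the machine `M` on the states in `S`. -/
inductive RewriteRule (M : Machine Γ Λ) (S : Set Λ) :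
    List (ConfigLetter Γ S) → List (ConfigLetter Γ S) → Prop
  | padRight (q : S) : RewriteRule M S [state q, right] [state q, sym default, right]
  | padLeft (q : S) : RewriteRule M S [left, state q] [left, sym default, state q]
  | moveRight (q : S) (a : Γ) (q' : S) (h : M q a = some (q'.1, Stmt.move Dir.right)) :
      RewriteRule M S [state q, sym a] [sym a, state q']
  | moveLeft (q : S) (a : Γ) (q' : S) (c : Γ) (h : M q a = some (q'.1, Stmt.move Dir.left)) :
      RewriteRule M S [sym c, state q, sym a] [state q', sym c, sym a]
  | write (q : S) (a : Γ) (q' : S) (b : Γ) (h : M q a = some (q'.1, Stmt.write b)) :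
      RewriteRule M S [state q, sym a] [state q', sym b]

/-- The set of rules of the semi-Thue system that simulates the machine `M`. -/
def rewriteRules (M : Machine Γ Λ) (S : Set Λ) :
    Set (List (ConfigLetter Γ S) × List (ConfigLetter Γ S)) :=
  {x | RewriteRule M S x.1 x.2}

theorem rewriteRules_finite [Finite Γ] (M : Machine Γ Λ) (hS : S.Finite) :
    (rewriteRules M S).Finite := by
  have := hS.to_subtype
  refine Set.Finite.subset
    ((Set.finite_range fun q : S => ([state q, right], [state q, sym (default : Γ), right])).union
    ((Set.finite_range fun q : S => ([left, state q], [left, sym (default : Γ), state q])).union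
    ((Set.finite_range fun x : S × Γ × S =>
      ([state x.1, sym x.2.1], [sym x.2.1, state x.2.2])).union
    ((Set.finite_range fun x : S × Γ × S × Γ =>
      ([sym x.2.2.2, state x.1, sym x.2.1], [state x.2.2.1, sym x.2.2.2, sym x.2.1])).union
    (Set.finite_range fun x : S × Γ × S × Γ =>
      ([state x.1, sym x.2.1], [state x.2.2.1, sym x.2.2.2])))))) ?_
  rintro ⟨_, _⟩ (q | q | ⟨q, a, q', h⟩ | ⟨q, a, q', c, h⟩ | ⟨q, a, q', b, h⟩)
  · exact .inl ⟨q, rfl⟩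
  · exact .inr (.inl ⟨q, rfl⟩)
  · exact .inr (.inr (.inl ⟨(q, a, q'), rfl⟩))
  · exact .inr (.inr (.inr (.inl ⟨(q, a, q', c), rfl⟩)))
  · exact .inr (.inr (.inr (.inr ⟨(q, a, q', b), rfl⟩)))

theorem step_configOf_cons (M : Machine Γ Λ) (L : List Γ) (q : S) (a : Γ) (R : List Γ) :
    step M (configOf L q (a :: R)) = (M q a).map fun x => ⟨x.1, match x.2 with
      | Stmt.move d => (Tape.mk' (ListBlank.mk L) (ListBlank.mk (a :: R))).move d
      | Stmt.write b => (Tape.mk' (ListBlank.mk L) (ListBlank.mk (a :: R))).write b⟩ := by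
  rfl

theorem step_moveRight {M : Machine Γ Λ} {L R : List Γ} {q q' : S} {a : Γ}
    (h : M q a = some (q'.1, Stmt.move Dir.right)) :
    step M (configOf L q (a :: R)) = some (configOf (a :: L) q' R) := by
  rw [step_configOf_cons, h]
  simp [configOf]

theorem step_moveLeft {M : Machine Γ Λ} {L R : List Γ} {q q' : S} {a c : Γ}
    (h : M q a = some (q'.1, Stmt.move Dir.left)) :
    step M (configOf (c :: L) q (a :: R)) = some (configOf L q' (c :: a :: R)) := by
  rw [step_configOf_cons, h]
  simp [configOf]

theorem step_write {M : Machine Γ Λ} {L R : List Γ} {q q' : S} {a b : Γ}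
    (h : M q a = some (q'.1, Stmt.write b)) :
    step M (configOf L q (a :: R)) = some (configOf L q' (b :: R)) := by
  rw [step_configOf_cons, h]
  simp [configOf]

theorem step_eq_none {M : Machine Γ Λ} {L R : List Γ} {q : S} {a : Γ} :
    step M (configOf L q (a :: R)) = none ↔ M q a = none := by
  rw [step_configOf_cons, Option.map_eq_none_iff]

/-- A rewriting step from the word of a configuration leads to the word of a configuration that the
machine reaches. -/
theorem reaches_of_semiThueStep {M : Machine Γ Λ} {L R : List Γ} {q : S}
    {w : List (ConfigLetter Γ S)} (h : SemiThueStep (rewriteRules M S) (configWord L q R) w) :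
    ∃ L' q' R', w = configWord L' q' R' ∧ Reaches M (configOf L q R) (configOf L' q' R') := by
  obtain ⟨p, l, r, s, hr, h, rfl⟩ := h
  rcases hr with q0 | q0 | ⟨q0, a, q', hM⟩ | ⟨q0, a, q', c, hM⟩ | ⟨q0, a, q', b, hM⟩
  · obtain ⟨rfl, rfl, hs⟩ := configWord_split (p := p) (s := right :: s) (by simpa using h)
    cases R with
    | cons a R => simp at hs
    | nil =>
      refine ⟨L, q, [default], ?_, ?_⟩
      · simp at hs
        simp [configWord, hs]
      -- Padding adds a blank that the infinite tape already had, so the machine does not move.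
      · rw [configOf_nil_right]
        exact Relation.ReflTransGen.refl
  · obtain ⟨hp, rfl, rfl⟩ := configWord_split (p := p ++ [left]) (s := s) (by simpa using h)
    cases L with
    | cons a L =>
      have hp' : (left :: L.reverse.map sym) ++ [sym a] = p ++ [left] := by simpa using hp
      have := (List.append_inj' hp' rfl).2
      simp at this
    | nil =>
      refine ⟨[default], q, R, ?_, ?_⟩
      · have : p = [] := by simpa using hp.symm
        simp [configWord, this]
      · rw [configOf_nil_left]
        exact Relation.ReflTransGen.refl
  · obtain ⟨rfl, rfl, hs⟩ := configWord_split (p := p) (s := sym a :: s) (by simpa using h)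
    cases R with
    | nil => simp at hs
    | cons a' R =>
      obtain ⟨rfl, rfl⟩ : a' = a ∧ R.map sym ++ [right] = s := by simpa using hs
      refine ⟨a' :: L, q', R, ?_, .single (step_moveRight hM)⟩
      simp [configWord]
  · obtain ⟨hp, rfl, hs⟩ := configWord_split (p := p ++ [sym c]) (s := sym a :: s) (by simpa using h)
    cases R with
    | nil => simp at hs
    | cons a' R =>
      obtain ⟨rfl, rfl⟩ : a' = a ∧ R.map sym ++ [right] = s := by simpa using hs
      cases L with
      -- The state letter comes right after the end marker, so the rule, which needs a tape symbol
      -- there, cannot apply.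
      | nil =>
        have := congrArg List.getLast? hp
        simp at this
      | cons c' L =>
        have hp' : (left :: L.reverse.map sym) ++ [sym c'] = p ++ [sym c] := by simpa using hp
        obtain ⟨rfl, hc⟩ := List.append_inj' hp' rfl
        obtain rfl : c' = c := by simpa using hc
        refine ⟨L, q', c' :: a' :: R, ?_, .single (step_moveLeft hM)⟩
        simp [configWord]
  · obtain ⟨rfl, rfl, hs⟩ := configWord_split (p := p) (s := sym a :: s) (by simpa using h)
    cases R with
    | nil => simp at hs
    | cons a' R =>
      obtain ⟨rfl, rfl⟩ : a' = a ∧ R.map sym ++ [right] = s := by simpa using hs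
      refine ⟨L, q', b :: R, ?_, .single (step_write hM)⟩
      simp [configWord]

theorem reaches_of_semiThue {M : Machine Γ Λ} {L R : List Γ} {q : S}
    {w : List (ConfigLetter Γ S)}
    (h : Relation.ReflTransGen (SemiThueStep (rewriteRules M S)) (configWord L q R) w) :
    ∃ L' q' R', w = configWord L' q' R' ∧ Reaches M (configOf L q R) (configOf L' q' R') := by
  induction h with
  | refl => exact ⟨L, q, R, rfl, .refl⟩
  | tail _ hs ih =>
    obtain ⟨L', q', R', rfl, h⟩ := ih
    obtain ⟨L'', q'', R'', rfl, h'⟩ := reaches_of_semiThueStep hs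
    exact ⟨L'', q'', R'', rfl, h.trans h'⟩

/-- Padding with a blank makes the tape under the head explicit. -/
theorem exists_pad_right (M : Machine Γ Λ) (L : List Γ) (q : S) (R : List Γ) :
    ∃ a R', configOf L q R = configOf L q (a :: R') ∧
      Relation.ReflTransGen (SemiThueStep (rewriteRules M S)) (configWord L q R)
        (configWord L q (a :: R')) := by
  cases R with
  | cons a R => exact ⟨a, R, rfl, .refl⟩
  | nil =>
    refine ⟨default, [], (configOf_nil_right L q).symm, .single ?_⟩
    exact ⟨left :: L.reverse.map sym, _, _, [], RewriteRule.padRight q, by simp [configWord],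
      by simp [configWord]⟩

theorem exists_pad_left (M : Machine Γ Λ) (L : List Γ) (q : S) (R : List Γ) :
    ∃ c L', configOf L q R = configOf (c :: L') q R ∧
      Relation.ReflTransGen (SemiThueStep (rewriteRules M S)) (configWord L q R)
        (configWord (c :: L') q R) := by
  cases L with
  | cons c L => exact ⟨c, L, rfl, .refl⟩
  | nil =>
    refine ⟨default, [], (configOf_nil_left q R).symm, .single ?_⟩
    exact ⟨[], _, _, R.map sym ++ [right], RewriteRule.padLeft q, by simp [configWord],
      by simp [configWord]⟩

/-- A step of the machine is simulated by rewriting. -/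
theorem semiThue_of_step {M : Machine Γ Λ} (hM : Supports M S) {L R : List Γ} {q : S}
    {c : Cfg Γ Λ} (h : c ∈ step M (configOf L q R)) :
    ∃ L' q' R', c = configOf L' q' R' ∧
      Relation.ReflTransGen (SemiThueStep (rewriteRules M S)) (configWord L q R)
        (configWord L' q' R') := by
  obtain ⟨a, R, hR, hw⟩ := exists_pad_right M L q R
  rw [hR] at h
  obtain ⟨x, hx⟩ : ∃ x, M q a = some x := by
    rw [← Option.ne_none_iff_exists', Ne, ← step_eq_none (L := L) (R := R), h]
    simp
  obtain ⟨q', stmt⟩ := x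
  -- The states in `S` are closed under transitions, so the new state is again a letter.
  have hq' : q' ∈ S := hM.2 hx q.2
  rcases stmt with (_ | _) | b
  · obtain ⟨c', L, hL, hw'⟩ := exists_pad_left M L q (a :: R)
    rw [hL, step_moveLeft (q' := ⟨q', hq'⟩) hx] at h
    refine ⟨_, _, _, (Option.some.inj h).symm, (hw.trans hw').tail ?_⟩
    exact ⟨left :: L.reverse.map sym, _, _, R.map sym ++ [right],
      RewriteRule.moveLeft q a ⟨q', hq'⟩ c' hx, by simp [configWord], by simp [configWord]⟩
  · rw [step_moveRight (q' := ⟨q', hq'⟩) hx] at h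
    refine ⟨_, _, _, (Option.some.inj h).symm, hw.tail ?_⟩
    exact ⟨left :: L.reverse.map sym, _, _, R.map sym ++ [right],
      RewriteRule.moveRight q a ⟨q', hq'⟩ hx, by simp [configWord], by simp [configWord]⟩
  · rw [step_write (q' := ⟨q', hq'⟩) hx] at h
    refine ⟨_, _, _, (Option.some.inj h).symm, hw.tail ?_⟩
    exact ⟨left :: L.reverse.map sym, _, _, R.map sym ++ [right],
      RewriteRule.write q a ⟨q', hq'⟩ b hx, by simp [configWord], by simp [configWord]⟩

theorem semiThue_of_reaches {M : Machine Γ Λ} (hM : Supports M S) {L R : List Γ} {q : S}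
    {c : Cfg Γ Λ} (h : Reaches M (configOf L q R) c) :
    ∃ L' q' R', c = configOf L' q' R' ∧
      Relation.ReflTransGen (SemiThueStep (rewriteRules M S)) (configWord L q R)
        (configWord L' q' R') := by
  induction h with
  | refl => exact ⟨L, q, R, rfl, .refl⟩
  | tail _ hs ih =>
    obtain ⟨L', q', R', rfl, h⟩ := ih
    obtain ⟨L'', q'', R'', rfl, h'⟩ := semiThue_of_step hM hs
    exact ⟨L'', q'', R'', rfl, h.trans h'⟩

/-- Words reachable by rewriting encode reachable configurations, and conversely up to padding. A
halting configuration may have no explicit symbol under the head, so one more padding on the right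
may be needed to expose its halting factor. -/
theorem eval_dom_iff_semiThue {M : Machine Γ Λ} (hM : Supports M S) (l : List Γ) :
    (eval M l).Dom ↔ ∃ w, Relation.ReflTransGen (SemiThueStep (rewriteRules M S))
      (configWord [] ⟨default, hM.1⟩ l) w ∧ ∃ h ∈ haltingFactors M S, h <:+: w := by
  have h0 : (init l : Cfg Γ Λ) = configOf [] (⟨default, hM.1⟩ : S) l := rfl
  simp only [eval, Part.map_Dom]
  rw [Part.dom_iff_mem, h0]
  simp only [StateTransition.mem_eval]
  constructor
  · rintro ⟨c, h1, h2⟩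
    obtain ⟨L', q', R', rfl, h⟩ := semiThue_of_reaches hM h1
    obtain ⟨a, R, hR, hw⟩ := exists_pad_right M L' q' R'
    rw [hR] at h2
    exact ⟨_, h.trans hw, _, ⟨q', a, step_eq_none.1 h2, rfl⟩,
      left :: L'.reverse.map sym, R.map sym ++ [right], by simp [configWord]⟩
  · rintro ⟨w, hw, _, ⟨q, a, hq, rfl⟩, p, s, h⟩
    obtain ⟨L', q', R', rfl, h'⟩ := reaches_of_semiThue hw
    obtain ⟨-, rfl, hs⟩ := configWord_split (p := p) (s := sym a :: s) (by simpa using h.symm)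
    refine ⟨_, h', ?_⟩
    cases R' with
    | nil => simp at hs
    | cons a' R =>
      obtain ⟨rfl, -⟩ : a' = a ∧ R.map sym ++ [right] = s := by simpa using hs
      exact step_eq_none.2 hq

end TM0

end Turing

/-! ### Derivations of terminal words, and their encoding as grammar descriptions -/

section Yields

variable {T N : Type*}

/-- `Yields R γ w` says that the context-free productions `R`, with terminals `T` and variables
`N`, derive the terminal word `w` from the sentential form `γ`. -/
inductive Yields (R : Set (N × List (T ⊕ N))) : List (T ⊕ N) → List T → Prop
  | nil : Yields R [] []
  | terminal {t γ w} (h : Yields R γ w) : Yields R (Sum.inl t :: γ) (t :: w)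
  | nonterminal {A δ γ u v} (hr : (A, δ) ∈ R) (hδ : Yields R δ u) (hγ : Yields R γ v) :
      Yields R (Sum.inr A :: γ) (u ++ v)

namespace Yields

variable {R : Set (N × List (T ⊕ N))}

theorem append {γ δ : List (T ⊕ N)} {u v : List T} (hγ : Yields R γ u) (hδ : Yields R δ v) :
    Yields R (γ ++ δ) (u ++ v) := by
  induction hγ with
  | nil => exact hδ
  | terminal _ ih => exact terminal ih
  | nonterminal hr h _ _ ih =>
    rw [List.append_assoc]
    exact nonterminal hr h ih

theorem exists_append {γ δ : List (T ⊕ N)} {w : List T} (h : Yields R (γ ++ δ) w) :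
    ∃ u v, w = u ++ v ∧ Yields R γ u ∧ Yields R δ v := by
  generalize hε : γ ++ δ = ε at h
  induction h generalizing γ with
  | nil =>
    obtain ⟨rfl, rfl⟩ := List.append_eq_nil_iff.1 hε
    exact ⟨[], [], rfl, nil, nil⟩
  | @terminal t γ' w h ih =>
    cases γ with
    | nil =>
      subst hε
      exact ⟨[], _, rfl, nil, terminal h⟩
    | cons s γ =>
      obtain ⟨rfl, hε'⟩ : s = Sum.inl t ∧ γ ++ δ = γ' := by simpa using hε
      obtain ⟨u, v, rfl, hu, hv⟩ := ih hε'
      exact ⟨t :: u, v, rfl, terminal hu, hv⟩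
  | @nonterminal A δ' γ' u' v' hr h h' _ ih =>
    cases γ with
    | nil =>
      subst hε
      exact ⟨[], _, rfl, nil, nonterminal hr h h'⟩
    | cons s γ =>
      obtain ⟨rfl, hε'⟩ : s = Sum.inr A ∧ γ ++ δ = γ' := by simpa using hε
      obtain ⟨u, v, rfl, hu, hv⟩ := ih hε'
      exact ⟨u' ++ u, v, (List.append_assoc _ _ _).symm, nonterminal hr h hu, hv⟩

theorem of_rule {A : N} {δ : List (T ⊕ N)} {w : List T} (hr : (A, δ) ∈ R) (h : Yields R δ w) :
    Yields R [Sum.inr A] w := by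
  simpa using nonterminal hr h nil

theorem map_inl (l : List T) : Yields R (l.map Sum.inl) l := by
  induction l with
  | nil => exact nil
  | cons t l ih => exact terminal ih

end Yields

/-- The words of the form described by the sentential form `γ`, if each variable `A` stands for the
words that satisfy `I A`. -/
def Interprets (I : N → List T → Prop) : List (T ⊕ N) → List T → Prop
  | [], w => w = []
  | Sum.inl t :: γ, w => ∃ v, w = t :: v ∧ Interprets I γ v
  | Sum.inr A :: γ, w => ∃ u v, w = u ++ v ∧ I A u ∧ Interprets I γ v

theorem Interprets.map_inl_append {I : N → List T → Prop} {l : List T} {γ : List (T ⊕ N)}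
    {w : List T} : Interprets I (l.map Sum.inl ++ γ) w ↔ ∃ v, w = l ++ v ∧ Interprets I γ v := by
  induction l generalizing w with
  | nil => simp
  | cons t l ih => simp [Interprets, ih]

theorem Interprets.map_inl {I : N → List T → Prop} {l w : List T} :
    Interprets I (l.map Sum.inl) w ↔ w = l := by
  simpa [Interprets] using Interprets.map_inl_append (I := I) (l := l) (γ := []) (w := w)

/-- An interpretation of the variables that is closed under the productions holds for all the
words that the productions derive. -/
theorem Yields.interprets {R : Set (N × List (T ⊕ N))} {I : N → List T → Prop}
    (hI : ∀ A δ, (A, δ) ∈ R → ∀ w, Interprets I δ w → I A w) {γ : List (T ⊕ N)} {w : List T}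
    (h : Yields R γ w) : Interprets I γ w := by
  induction h with
  | nil => rfl
  | terminal _ ih => exact ⟨_, rfl, ih⟩
  | nonterminal hr _ _ ih₁ ih₂ => exact ⟨_, _, rfl, hI _ _ hr _ ih₁, ih₂⟩

theorem Yields.interprets_nonterminal {R : Set (N × List (T ⊕ N))} {I : N → List T → Prop}
    (hI : ∀ A δ, (A, δ) ∈ R → ∀ w, Interprets I δ w → I A w) {A : N} {w : List T}
    (h : Yields R [Sum.inr A] w) : I A w := by
  obtain ⟨u, v, rfl, hu, rfl⟩ := h.interprets hI
  simpa using hu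

/-- The description of a production under namings of the terminals and the variables. -/
def encodeProduction (eT : T → ℕ) (eN : N → ℕ) (r : N × List (T ⊕ N)) : ℕ × List SymbolCode :=
  (eN r.1, r.2.map (Sum.map eT eN))

theorem CFGCode.mem_rules {G : CFGCode} {r : ContextFreeRule ℕ ℕ} :
    r ∈ (CFGCode.toGrammar G).rules ↔ ∃ p ∈ G.2, ⟨p.1, p.2.map SymbolCode.toSymbol⟩ = r := by
  exact List.mem_toFinset.trans List.mem_map

theorem SymbolCode.toSymbol_injective : Function.Injective SymbolCode.toSymbol := by
  rintro (a | a) (b | b) h <;> simp_all [SymbolCode.toSymbol]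

variable {R : Set (N × List (T ⊕ N))} {eT : T → ℕ} {eN : N → ℕ} {G : CFGCode}

/-- The grammar symbol that names a terminal or a variable. -/
def encodeSymbol (eT : T → ℕ) (eN : N → ℕ) (s : T ⊕ N) : Symbol ℕ ℕ :=
  SymbolCode.toSymbol (Sum.map eT eN s)

theorem encodeSymbol_injective (hT : Function.Injective eT) (hN : Function.Injective eN) :
    Function.Injective (encodeSymbol eT eN) :=
  SymbolCode.toSymbol_injective.comp (hT.sumMap hN)

theorem Yields.derives (hG : ∀ p, p ∈ G.2 ↔ ∃ r ∈ R, encodeProduction eT eN r = p)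
    {γ : List (T ⊕ N)} {w : List T} (h : Yields R γ w) :
    (CFGCode.toGrammar G).Derives (γ.map (encodeSymbol eT eN))
      ((w.map eT).map Symbol.terminal) := by
  induction h with
  | nil => exact Relation.ReflTransGen.refl
  | @terminal t γ w _ ih => exact ih.append_left [Symbol.terminal (eT t)]
  | @nonterminal A δ γ u v hr _ _ ih₁ ih₂ =>
    have h1 : (CFGCode.toGrammar G).Produces [Symbol.nonterminal (eN A)]
        (δ.map (encodeSymbol eT eN)) := by
      refine ⟨⟨eN A, δ.map (encodeSymbol eT eN)⟩, ?_, ContextFreeRule.Rewrites.input_output⟩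
      refine CFGCode.mem_rules.2 ⟨_, (hG _).2 ⟨_, hr, rfl⟩, ?_⟩
      simp only [encodeProduction, List.map_map]
      rfl
    have h2 := ((h1.single.trans ih₁).append_right (γ.map (encodeSymbol eT eN))).trans
      (ih₂.append_left ((u.map eT).map Symbol.terminal))
    simp only [List.map_append]
    exact h2

theorem Yields.of_map_eq_map_terminal {γ : List (T ⊕ N)} {w : List ℕ}
    (h : γ.map (encodeSymbol eT eN) = w.map Symbol.terminal) :
    ∃ w₀, Yields R γ w₀ ∧ w = w₀.map eT := by
  induction γ generalizing w with
  | nil =>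
    obtain rfl : w = [] := by simpa using h.symm
    exact ⟨[], nil, rfl⟩
  | cons s γ ih =>
    cases w with
    | nil => simp at h
    | cons a w =>
      simp only [List.map_cons, List.cons.injEq] at h
      obtain ⟨w₀, h₀, rfl⟩ := ih h.2
      rcases s with t | A
      · obtain rfl : eT t = a := by simpa [encodeSymbol, SymbolCode.toSymbol] using h.1
        exact ⟨t :: w₀, terminal h₀, rfl⟩
      · exact absurd h.1 (by simp [encodeSymbol, SymbolCode.toSymbol])

/-- Induction on the derivation from its first step: the word yielded by the rewritten form is cut
along the replaced body, and the middle piece is folded back under the variable. -/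
theorem Yields.of_derives (hT : Function.Injective eT) (hN : Function.Injective eN)
    (hG : ∀ p, p ∈ G.2 ↔ ∃ r ∈ R, encodeProduction eT eN r = p)
    {γ : List (T ⊕ N)} {u : List (Symbol ℕ ℕ)} {w : List ℕ} (hu : γ.map (encodeSymbol eT eN) = u)
    (h : (CFGCode.toGrammar G).Derives u (w.map Symbol.terminal)) :
    ∃ w₀, Yields R γ w₀ ∧ w = w₀.map eT := by
  induction h using Relation.ReflTransGen.head_induction_on generalizing γ with
  | refl => exact Yields.of_map_eq_map_terminal hu
  | head hs _ ih =>
    obtain ⟨r, hr, hs⟩ := hs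
    obtain ⟨p, q, rfl, rfl⟩ := hs.exists_parts
    obtain ⟨p₀, hp₀, rfl⟩ := CFGCode.mem_rules.1 hr
    obtain ⟨⟨A, δ⟩, hAδ, rfl⟩ := (hG _).1 hp₀
    obtain ⟨γ₁, γ₂, rfl, h1, rfl⟩ := List.map_eq_append_iff.1 hu
    obtain ⟨γ₃, γ₄, rfl, rfl, h4⟩ := List.map_eq_append_iff.1 h1
    obtain ⟨s, γ₅, rfl, hs', h5⟩ := List.map_eq_cons_iff.1 h4
    obtain rfl := List.map_eq_nil_iff.1 h5
    obtain rfl : s = Sum.inr A := encodeSymbol_injective hT hN hs'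
    obtain ⟨w₀, h₀, rfl⟩ := ih (γ := γ₃ ++ δ ++ γ₂) (by
      simp only [List.map_append, encodeProduction, List.map_map]
      rfl)
    obtain ⟨u, v, rfl, hu', hv⟩ := h₀.exists_append
    obtain ⟨u₁, u₂, rfl, hu₁, hu₂⟩ := hu'.exists_append
    exact ⟨_, (hu₁.append (of_rule hAδ hu₂)).append hv, rfl⟩

theorem CFGCode.mem_language_iff (hT : Function.Injective eT) (hN : Function.Injective eN)
    (hG : ∀ p, p ∈ G.2 ↔ ∃ r ∈ R, encodeProduction eT eN r = p) {A : N} (hA : G.1 = eN A)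
    {w : List ℕ} :
    w ∈ (CFGCode.toGrammar G).language ↔ ∃ w₀, Yields R [Sum.inr A] w₀ ∧ w = w₀.map eT := by
  have hi : [Symbol.nonterminal (CFGCode.toGrammar G).initial] =
      [Sum.inr A].map (encodeSymbol eT eN) := by
    simp only [CFGCode.toGrammar, hA]
    rfl
  rw [ContextFreeGrammar.mem_language_iff, hi]
  constructor
  · exact Yields.of_derives hT hN hG rfl
  · rintro ⟨w₀, h, rfl⟩
    exact h.derives hG

theorem generatesSquare_iff (hT : Function.Injective eT) (hN : Function.Injective eN)
    (hG : ∀ p, p ∈ G.2 ↔ ∃ r ∈ R, encodeProduction eT eN r = p) {A : N} (hA : G.1 = eN A) :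
    GeneratesSquare G ↔ ∃ w, Yields R [Sum.inr A] w ∧ IsSquareWord w := by
  simp only [GeneratesSquare, CFGCode.mem_language_iff hT hN hG hA]
  constructor
  · rintro ⟨_, ⟨w, hw, rfl⟩, x, hx, h⟩
    obtain ⟨y, z, rfl, hy, hz⟩ := List.map_eq_append_iff.1 h
    -- The two halves have equal names letter by letter, and the naming is injective.
    obtain rfl : y = z := hT.list_map (hy.trans hz.symm)
    exact ⟨_, hw, y, by rintro rfl; exact hx hy.symm, rfl⟩
  · rintro ⟨w, hw, x, hx, rfl⟩
    exact ⟨_, ⟨_, hw, rfl⟩, x.map eT, by simpa using hx, by simp⟩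

end Yields

/-! ### The grammar whose squares are halting runs -/

/-- Terminals of the grammar whose squares encode halting runs of a semi-Thue system over `α`. -/
inductive RunTerminal (α : Type*)
  | letter (a : α)
  | sharp
  | dollar
  | mark

/-- Variables of the grammar whose squares encode halting runs of a semi-Thue system. -/
inductive RunVariable
  | start
  | chain
  | step
  | copy
  | run
  | link
  | palindrome
  | halt

open RunTerminal RunVariable

instance {α : Type*} [Finite α] : Finite (RunTerminal α) :=
  Finite.of_surjective
    (fun x : Option (Option (Option α)) => match x with
      | none => sharp
      | some none => dollar
      | some (some none) => mark
      | some (some (some a)) => letter a)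
    fun
      | letter a => ⟨some (some (some a)), rfl⟩
      | sharp => ⟨none, rfl⟩
      | dollar => ⟨some none, rfl⟩
      | mark => ⟨some (some none), rfl⟩

instance : Finite RunVariable :=
  Set.finite_univ_iff.1
    ((Set.toFinite {start, chain, step, copy, run, link, palindrome, halt}).subset
      fun A _ => by cases A <;> simp)

section Runs

variable {α : Type*} (R : Set (List α × List α)) (H : Set (List α))

/-- Concatenations of blocks `C # Dᴿ $` in which `D` is obtained from `C` in at most one rewriting
step. -/
inductive IsStepChain : List (RunTerminal α) → Prop
  | nil : IsStepChain []
  | cons {C D : List α} {y : List (RunTerminal α)} (h : C = D ∨ SemiThueStep R C D) (hy : IsStepChain y) :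
      IsStepChain (C.map letter ++ sharp :: (D.reverse.map letter ++ dollar :: y))

/-- Concatenations of blocks `Dᴿ $ D #` followed by a block `Dᴿ $` in which `D` has a factor
in `H`. -/
inductive IsLinkChain : List (RunTerminal α) → Prop
  | halt {D h : List α} (hh : h ∈ H) (hD : h <:+: D) : IsLinkChain (D.reverse.map letter ++ [dollar])
  | cons {D : List α} {z : List (RunTerminal α)} (hz : IsLinkChain z) :
      IsLinkChain (D.reverse.map letter ++ dollar :: (D.map letter ++ sharp :: z))

variable {R H}

theorem IsStepChain.mark_notMem {w : List (RunTerminal α)} (h : IsStepChain R w) : mark ∉ w := by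
  induction h with
  | nil => simp
  | cons _ _ ih => simp [ih]

theorem IsLinkChain.mark_notMem {w : List (RunTerminal α)} (h : IsLinkChain H w) : mark ∉ w := by
  induction h with
  | halt => simp
  | cons _ ih => simp [ih]

theorem map_letter_append_cons_inj {l l' : List α} {t t' : RunTerminal α}
    {r r' : List (RunTerminal α)} (ht : ∀ a, t ≠ letter a) (ht' : ∀ a, t' ≠ letter a)
    (h : l.map letter ++ t :: r = l'.map letter ++ t' :: r') : l = l' ∧ t = t' ∧ r = r' := by
  induction l generalizing l' with
  | nil =>
    cases l' with
    | nil => simpa using h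
    | cons a l' => exact absurd (by simpa using h : t = letter a ∧ _).1 (ht a)
  | cons a l ih =>
    cases l' with
    | nil => exact absurd (by simpa using h : letter a = t' ∧ _).1.symm (ht' a)
    | cons a' l' =>
      simp only [List.map_cons, List.cons_append, List.cons.injEq, letter.injEq] at h
      obtain ⟨rfl, h1, h2⟩ := ih h.2
      exact ⟨by rw [h.1], h1, h2⟩

/-- One word is parsed in two ways. The separators are not letters, so the parsings agree at each of
them: the `D` of a step block is the `D` of the link, which is in turn the `C` of the next step
block. -/
theorem IsLinkChain.exists_run {z : List (RunTerminal α)} (hz : IsLinkChain H z) {C : List α}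
    (h : IsStepChain R (C.map letter ++ sharp :: z)) :
    ∃ D, Relation.ReflTransGen (SemiThueStep R) C D ∧ ∃ h ∈ H, h <:+: D := by
  generalize hw : C.map letter ++ sharp :: z = w at h
  induction hz generalizing C w with
  | @halt D h' hh hD =>
    cases h with
    | nil => simp at hw
    | cons hs hy =>
      obtain ⟨rfl, -, h1⟩ := map_letter_append_cons_inj (by simp) (by simp) hw
      obtain ⟨h2, -, -⟩ := map_letter_append_cons_inj (by simp) (by simp) h1
      obtain rfl := List.reverse_injective h2
      refine ⟨D, ?_, h', hh, hD⟩
      rcases hs with rfl | hs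
      · exact .refl
      · exact .single hs
  | @cons D z hz ih =>
    cases h with
    | nil => simp at hw
    | cons hs hy =>
      obtain ⟨rfl, -, h1⟩ := map_letter_append_cons_inj (by simp) (by simp) hw
      obtain ⟨h2, -, h3⟩ := map_letter_append_cons_inj (by simp) (by simp) h1
      obtain rfl := List.reverse_injective h2
      obtain ⟨E, hE, hE'⟩ := ih _ h3 hy
      refine ⟨E, ?_, hE'⟩
      rcases hs with rfl | hs
      · exact hE
      · exact hE.head hs

theorem exists_isLinkChain_isStepChain {C D : List α} (h : Relation.ReflTransGen (SemiThueStep R) C D)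
    (hD : ∃ h ∈ H, h <:+: D) :
    ∃ z, IsLinkChain H z ∧ IsStepChain R (C.map letter ++ sharp :: z) := by
  obtain ⟨f, hf, hD⟩ := hD
  induction h using Relation.ReflTransGen.head_induction_on with
  -- Even a run without steps needs one block before its final `Dᴿ $`; this is where step blocks
  -- with `C = D` are needed.
  | refl => exact ⟨_, .halt hf hD, .cons (.inl rfl) .nil⟩
  | head hs _ ih =>
    obtain ⟨z, hz, hc⟩ := ih
    exact ⟨_, .cons hz, .cons (.inr hs) hc⟩

/-- The productions that do not depend on the initial word of the semi-Thue system. -/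
inductive RunProduction (R : Set (List α × List α)) (H : Set (List α)) :
    RunVariable → List (RunTerminal α ⊕ RunVariable) → Prop
  | start : RunProduction R H start [.inl mark, .inr chain, .inl mark, .inr run]
  | chain_nil : RunProduction R H chain []
  | chain_cons : RunProduction R H chain [.inr step, .inl dollar, .inr chain]
  | step_letter (a : α) : RunProduction R H step [.inl (letter a), .inr step, .inl (letter a)]
  | step_copy : RunProduction R H step [.inr copy]
  | step_rule {l r : List α} (h : (l, r) ∈ R) :
      RunProduction R H step
        ((l.map letter).map .inl ++ .inr copy :: (r.reverse.map letter).map .inl)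
  | copy_letter (a : α) : RunProduction R H copy [.inl (letter a), .inr copy, .inl (letter a)]
  | copy_sharp : RunProduction R H copy [.inl sharp]
  | link_cons : RunProduction R H link [.inr palindrome, .inl sharp, .inr link]
  | link_halt : RunProduction R H link [.inr halt, .inl dollar]
  | palindrome_letter (a : α) :
      RunProduction R H palindrome [.inl (letter a), .inr palindrome, .inl (letter a)]
  | palindrome_dollar : RunProduction R H palindrome [.inl dollar]
  | halt_left (a : α) : RunProduction R H halt [.inl (letter a), .inr halt]
  | halt_right (a : α) : RunProduction R H halt [.inr halt, .inl (letter a)]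
  | halt_factor {h : List α} (hh : h ∈ H) :
      RunProduction R H halt ((h.reverse.map letter).map .inl)

/-- The production that fixes the initial word of the semi-Thue system. -/
def initialProduction (w₀ : List α) : RunVariable × List (RunTerminal α ⊕ RunVariable) :=
  (run, (w₀.map letter).map .inl ++ [.inl sharp, .inr link])

/-- The productions of the grammar whose squares encode the halting runs that start with `w₀`. -/
def runProductions (R : Set (List α × List α)) (H : Set (List α)) (w₀ : List α) :
    Set (RunVariable × List (RunTerminal α ⊕ RunVariable)) :=
  insert (initialProduction w₀) {x | RunProduction R H x.1 x.2}

/-- The words derived from the variables of the grammar `runProductions R H w₀`. -/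
def runInterpretation (R : Set (List α × List α)) (H : Set (List α)) (w₀ : List α) :
    RunVariable → List (RunTerminal α) → Prop
  | start, w => ∃ x z, IsStepChain R x ∧ IsLinkChain H z ∧
      w = mark :: (x ++ mark :: (w₀.map letter ++ sharp :: z))
  | chain, w => IsStepChain R w
  | step, w => ∃ C D, (C = D ∨ SemiThueStep R C D) ∧
      w = C.map letter ++ sharp :: D.reverse.map letter
  | copy, w => ∃ C : List α, w = C.map letter ++ sharp :: C.reverse.map letter
  | run, w => ∃ z, IsLinkChain H z ∧ w = w₀.map letter ++ sharp :: z
  | link, w => IsLinkChain H w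
  | palindrome, w => ∃ C : List α, w = C.reverse.map letter ++ dollar :: C.map letter
  | halt, w => ∃ D, (∃ h ∈ H, h <:+: D) ∧ w = D.reverse.map letter

theorem SemiThueStep.cons {u v : List α} (h : SemiThueStep R u v) (a : α) :
    SemiThueStep R (a :: u) (a :: v) := by
  obtain ⟨p, l, r, s, hr, rfl, rfl⟩ := h
  exact ⟨a :: p, l, r, s, hr, rfl, rfl⟩

theorem runInterpretation_closed (w₀ : List α) (A : RunVariable)
    (δ : List (RunTerminal α ⊕ RunVariable)) (hA : (A, δ) ∈ runProductions R H w₀)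
    (w : List (RunTerminal α)) (hw : Interprets (runInterpretation R H w₀) δ w) :
    runInterpretation R H w₀ A w := by
  rcases hA with hA | hA
  · obtain ⟨rfl, rfl⟩ := Prod.mk.inj hA
    obtain ⟨_, rfl, _, rfl, _, _, rfl, hz, rfl⟩ := Interprets.map_inl_append.1 hw
    exact ⟨_, hz, by simp⟩
  · cases hA with
    | start =>
      obtain ⟨_, rfl, _, _, rfl, hx, _, rfl, _, _, rfl, ⟨z, hz, rfl⟩, rfl⟩ := hw
      exact ⟨_, z, hx, hz, by simp⟩
    | chain_nil =>
      obtain rfl := hw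
      exact IsStepChain.nil
    | chain_cons =>
      obtain ⟨_, _, rfl, ⟨C, D, h, rfl⟩, _, rfl, _, _, rfl, hy, rfl⟩ := hw
      simpa [runInterpretation] using IsStepChain.cons h hy
    | step_letter a =>
      obtain ⟨_, rfl, _, _, rfl, ⟨C, D, h, rfl⟩, _, rfl, rfl⟩ := hw
      refine ⟨a :: C, a :: D, ?_, by simp⟩
      rcases h with rfl | h
      · exact .inl rfl
      · exact .inr (h.cons a)
    | step_copy =>
      obtain ⟨_, _, rfl, ⟨C, rfl⟩, rfl⟩ := hw
      exact ⟨C, C, .inl rfl, by simp⟩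
    | @step_rule l r h =>
      obtain ⟨_, rfl, _, _, rfl, ⟨C, rfl⟩, hv⟩ := Interprets.map_inl_append.1 hw
      obtain rfl := Interprets.map_inl.1 hv
      -- The rule is applied at the very beginning; the common prefix is added around it by
      -- `step_letter`.
      exact ⟨l ++ C, r ++ C, .inr ⟨[], l, r, C, h, rfl, rfl⟩, by simp⟩
    | copy_letter a =>
      obtain ⟨_, rfl, _, _, rfl, ⟨C, rfl⟩, _, rfl, rfl⟩ := hw
      exact ⟨a :: C, by simp⟩
    | copy_sharp =>
      obtain ⟨_, rfl, rfl⟩ := hw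
      exact ⟨[], rfl⟩
    | link_cons =>
      obtain ⟨_, _, rfl, ⟨C, rfl⟩, _, rfl, _, _, rfl, hz, rfl⟩ := hw
      simpa [runInterpretation] using IsLinkChain.cons (D := C) hz
    | link_halt =>
      obtain ⟨_, _, rfl, ⟨D, ⟨h, hh, hD⟩, rfl⟩, _, rfl, rfl⟩ := hw
      exact IsLinkChain.halt hh hD
    | palindrome_letter a =>
      obtain ⟨_, rfl, _, _, rfl, ⟨C, rfl⟩, _, rfl, rfl⟩ := hw
      exact ⟨C ++ [a], by simp⟩
    | palindrome_dollar =>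
      obtain ⟨_, rfl, rfl⟩ := hw
      exact ⟨[], rfl⟩
    | halt_left a =>
      obtain ⟨_, rfl, _, _, rfl, ⟨D, ⟨h, hh, hD⟩, rfl⟩, rfl⟩ := hw
      -- The derived word is `Dᴿ`, so a letter put in front of it extends `D` at its end.
      exact ⟨D ++ [a], ⟨h, hh, hD.trans (List.prefix_append D [a]).isInfix⟩, by simp⟩
    | halt_right a =>
      obtain ⟨_, _, rfl, ⟨D, ⟨h, hh, hD⟩, rfl⟩, _, rfl, rfl⟩ := hw
      exact ⟨a :: D, ⟨h, hh, hD.trans (List.suffix_cons a D).isInfix⟩, by simp⟩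
    | @halt_factor h hh =>
      obtain rfl := Interprets.map_inl.1 hw
      exact ⟨h, ⟨h, hh, List.infix_rfl⟩, rfl⟩

variable {w₀ : List α}

theorem RunProduction.yields {A : RunVariable} {δ : List (RunTerminal α ⊕ RunVariable)}
    {w : List (RunTerminal α)} (h : RunProduction R H A δ)
    (hw : Yields (runProductions R H w₀) δ w) : Yields (runProductions R H w₀) [.inr A] w :=
  Yields.of_rule (Set.mem_insert_of_mem _ h) hw

theorem yields_letters {A : RunVariable}
    (h : ∀ a, RunProduction R H A [.inl (letter a), .inr A, .inl (letter a)])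
    (l : List α) {w : List (RunTerminal α)} (hw : Yields (runProductions R H w₀) [.inr A] w) :
    Yields (runProductions R H w₀) [.inr A] (l.map letter ++ w ++ l.reverse.map letter) := by
  induction l with
  | nil => simpa using hw
  | cons a l ih =>
    have := (h a).yields (.terminal (ih.append (.terminal .nil)))
    simpa using this

theorem yields_copy (C : List α) : Yields (runProductions R H w₀) [.inr copy]
    (C.map letter ++ sharp :: C.reverse.map letter) := by
  have := yields_letters (w₀ := w₀) (R := R) (H := H) .copy_letter C
    (RunProduction.copy_sharp.yields (.terminal .nil))
  simpa using this

theorem yields_palindrome (C : List α) : Yields (runProductions R H w₀) [.inr palindrome]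
    (C.reverse.map letter ++ dollar :: C.map letter) := by
  have := yields_letters (w₀ := w₀) (R := R) (H := H) .palindrome_letter C.reverse
    (RunProduction.palindrome_dollar.yields (.terminal .nil))
  simpa using this

theorem yields_step {C D : List α} (h : C = D ∨ SemiThueStep R C D) :
    Yields (runProductions R H w₀) [.inr step]
      (C.map letter ++ sharp :: D.reverse.map letter) := by
  rcases h with rfl | ⟨p, l, r, s, hr, rfl, rfl⟩
  · exact RunProduction.step_copy.yields (yields_copy C)
  · have h1 := (RunProduction.step_rule hr).yields (w₀ := w₀) (H := H)
      ((Yields.map_inl (l.map letter)).append ((yields_copy s).append (Yields.map_inl _)))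
    have := yields_letters (w₀ := w₀) (R := R) (H := H) .step_letter p h1
    simpa using this

theorem IsStepChain.yields {w : List (RunTerminal α)} (h : IsStepChain R w) :
    Yields (runProductions R H w₀) [.inr chain] w := by
  induction h with
  | nil => exact RunProduction.chain_nil.yields .nil
  | cons h _ ih =>
    have := RunProduction.chain_cons.yields ((yields_step h).append (.terminal ih))
    simpa using this

theorem yields_halt {h D : List α} (hh : h ∈ H) (hD : h <:+: D) :
    Yields (runProductions R H w₀) [.inr halt] (D.reverse.map letter) := by
  obtain ⟨p, s, rfl⟩ := hD
  -- In `sᴿ hᴿ pᴿ` the letters of `p` are attached on the right and then those of `s` on the left.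
  have h1 : Yields (runProductions R H w₀) [.inr halt]
      (h.reverse.map letter ++ p.reverse.map letter) := by
    induction p with
    | nil => simpa using (RunProduction.halt_factor hh).yields (Yields.map_inl _)
    | cons a p ih =>
      simpa using (RunProduction.halt_right a).yields (ih.append (.terminal .nil))
  induction s using List.reverseRecOn with
  | nil => simpa using h1
  | append_singleton s a ih => simpa using (RunProduction.halt_left a).yields (.terminal ih)

theorem IsLinkChain.yields {w : List (RunTerminal α)} (h : IsLinkChain H w) :
    Yields (runProductions R H w₀) [.inr link] w := by
  induction h with
  | halt hh hD => exact RunProduction.link_halt.yields ((yields_halt hh hD).append (.terminal .nil))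
  | @cons D z _ ih =>
    have := RunProduction.link_cons.yields ((yields_palindrome D).append (.terminal ih))
    simpa using this

/-- Soundness holds because `runInterpretation` is closed under the productions; completeness comes
from explicit derivations. -/
theorem yields_start_iff {w : List (RunTerminal α)} :
    Yields (runProductions R H w₀) [.inr start] w ↔ ∃ x z, IsStepChain R x ∧ IsLinkChain H z ∧
      w = mark :: (x ++ mark :: (w₀.map letter ++ sharp :: z)) := by
  constructor
  · exact Yields.interprets_nonterminal (runInterpretation_closed w₀)
  · rintro ⟨x, z, hx, hz, rfl⟩
    refine RunProduction.start.yields (.terminal (hx.yields.append (.terminal ?_)))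
    refine Yields.of_rule (Set.mem_insert _ _) ((Yields.map_inl _).append (.terminal hz.yields))

/-- The grammar derives a square if and only if the semi-Thue system rewrites `w₀` to a word with a
factor in `H`. -/
theorem exists_yields_square_iff :
    (∃ w, Yields (runProductions R H w₀) [.inr start] w ∧ IsSquareWord w) ↔
      ∃ D, Relation.ReflTransGen (SemiThueStep R) w₀ D ∧ ∃ h ∈ H, h <:+: D := by
  simp only [yields_start_iff]
  constructor
  · rintro ⟨w, ⟨x, z, hx, hz, rfl⟩, y, hy, h⟩
    cases y with
    | nil => exact absurd rfl hy
    | cons t y =>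
      obtain ⟨rfl, h⟩ : mark = t ∧ x ++ mark :: (w₀.map letter ++ sharp :: z) = y ++ t :: y := by
        simpa using h
      -- Past the initial `mark` only one is left, and it must be the one that opens the second
      -- half.
      obtain ⟨rfl, -, rfl⟩ := List.append_cons_inj_of_forall_not (P := (· = mark))
        (fun b hb hm => hx.mark_notMem (hm ▸ hb))
        (fun b hb hm => by subst hm; simp [hz.mark_notMem] at hb) rfl h
      exact hz.exists_run hx
  · rintro ⟨D, hD, hH⟩
    obtain ⟨z, hz, hx⟩ := exists_isLinkChain_isStepChain hD hH
    exact ⟨_, ⟨_, z, hx, hz, rfl⟩, mark :: (w₀.map letter ++ sharp :: z), by simp, by simp⟩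

/-- A finite superset suffices: any head is paired with any body from finitely many finite families.
-/
theorem runProduction_finite [Finite α] (hR : R.Finite) (hH : H.Finite) :
    {x : RunVariable × List (RunTerminal α ⊕ RunVariable) | RunProduction R H x.1 x.2}.Finite := by
  let F : Set (List (RunTerminal α ⊕ RunVariable)) :=
    {[.inl mark, .inr chain, .inl mark, .inr run], [], [.inr step, .inl dollar, .inr chain],
      [.inr copy], [.inl sharp], [.inr palindrome, .inl sharp, .inr link], [.inr halt, .inl dollar],
      [.inl dollar]}
  let F₁ : Set (List (RunTerminal α ⊕ RunVariable)) :=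
    Set.range fun x : α × RunVariable => [.inl (letter x.1), .inr x.2, .inl (letter x.1)]
  let F₂ : Set (List (RunTerminal α ⊕ RunVariable)) :=
    (fun x : List α × List α =>
      (x.1.map letter).map .inl ++ .inr copy :: (x.2.reverse.map letter).map .inl) '' R
  let F₃ : Set (List (RunTerminal α ⊕ RunVariable)) :=
    Set.range fun a : α => [.inl (letter a), .inr halt]
  let F₄ : Set (List (RunTerminal α ⊕ RunVariable)) :=
    Set.range fun a : α => [.inr halt, .inl (letter a)]
  let F₅ : Set (List (RunTerminal α ⊕ RunVariable)) :=
    (fun h : List α => (h.reverse.map letter).map .inl) '' H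
  have hF : (F ∪ (F₁ ∪ (F₂ ∪ (F₃ ∪ (F₄ ∪ F₅))))).Finite :=
    (Set.toFinite F).union ((Set.finite_range _).union ((hR.image _).union
      ((Set.finite_range _).union ((Set.finite_range _).union (hH.image _)))))
  refine (Set.finite_univ.prod hF).subset ?_
  rintro ⟨A, δ⟩ h
  refine ⟨Set.mem_univ _, ?_⟩
  cases (show RunProduction R H A δ from h) with
  | step_letter a => exact .inr (.inl ⟨(a, step), rfl⟩)
  | copy_letter a => exact .inr (.inl ⟨(a, copy), rfl⟩)
  | palindrome_letter a => exact .inr (.inl ⟨(a, palindrome), rfl⟩)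
  | @step_rule l r hr => exact .inr (.inr (.inl ⟨(l, r), hr, rfl⟩))
  | halt_left a => exact .inr (.inr (.inr (.inl ⟨a, rfl⟩)))
  | halt_right a => exact .inr (.inr (.inr (.inr (.inl ⟨a, rfl⟩))))
  | halt_factor hh => exact .inr (.inr (.inr (.inr (.inr ⟨_, hh, rfl⟩))))
  | _ => exact .inl (by simp [F])

end Runs

/-! ### The computable reduction -/

open RunTerminal RunVariable in
/-- For a fixed semi-Thue system, a grammar whose squares encode the halting runs from a word of the
form `p ++ replicate n a ++ s` is computable from `n`. -/
theorem exists_computable_generatesSquare {α : Type*} [Finite α] {R : Set (List α × List α)}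
    {H : Set (List α)} (hR : R.Finite) (hH : H.Finite) (p s : List α) (a : α) :
    ∃ G : ℕ → CFGCode, Computable G ∧ ∀ n, GeneratesSquare (G n) ↔
      ∃ D, Relation.ReflTransGen (SemiThueStep R) (p ++ List.replicate n a ++ s) D ∧
        ∃ h ∈ H, h <:+: D := by
  obtain ⟨eT, hT⟩ := Countable.exists_injective_nat (RunTerminal α)
  obtain ⟨eN, hN⟩ := Countable.exists_injective_nat RunVariable
  have hfin := runProduction_finite hR hH
  -- This list does not depend on `n`, so it enters the algorithm as a constant and may be chosen
  -- non-effectively.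
  let L : List (ℕ × List SymbolCode) := hfin.toFinset.toList.map (encodeProduction eT eN)
  let c : List α → List SymbolCode := List.map fun b => Sum.inl (eT (letter b))
  have hc : ∀ w₀, encodeProduction eT eN (initialProduction w₀) =
      (eN run, c w₀ ++ [Sum.inl (eT sharp), Sum.inr (eN link)]) := by
    intro w₀
    simp [encodeProduction, initialProduction, c]
  refine ⟨fun n => (eN start, encodeProduction eT eN
    (initialProduction (p ++ List.replicate n a ++ s)) :: L), ?_, fun n => ?_⟩
  · have h1 : Primrec fun n : ℕ =>
        (List.range n).map fun _ => (Sum.inl (eT (letter a)) : SymbolCode) :=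
      Primrec.list_map Primrec.list_range (Primrec.const _).to₂
    have h2 : Primrec fun n : ℕ => c p ++ ((List.range n).map
        fun _ => (Sum.inl (eT (letter a)) : SymbolCode)) ++ (c s ++
          [Sum.inl (eT sharp), Sum.inr (eN link)]) :=
      Primrec.list_append.comp (Primrec.list_append.comp (Primrec.const _) h1) (Primrec.const _)
    refine ((Primrec.const (eN start)).pair (Primrec.list_cons.comp
      ((Primrec.const (eN run)).pair h2) (Primrec.const L))).to_comp.of_eq fun n => ?_
    rw [hc]
    simp [c]
  · rw [generatesSquare_iff (R := runProductions R H (p ++ List.replicate n a ++ s)) (A := start)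
      hT hN _ rfl, exists_yields_square_iff]
    intro x
    simp [L, runProductions, eq_comm]

theorem theorem4 : ¬ ComputablePred (fun G : CFGCode => GeneratesSquare G) := by
  intro h
  obtain ⟨Γ, Λ, _, _, _, M, S, hS, hM, p, x, hn⟩ := exists_turingMachine
  have := hS.to_subtype
  obtain ⟨G, hG, hsq⟩ := exists_computable_generatesSquare
    (Turing.TM0.rewriteRules_finite M hS) (Turing.TM0.haltingFactors_finite M hS)
    -- With the repeated letter and the suffix, this is the word of the initial configuration:
    -- nothing to the left of the head, default state, input to the right.
    (.left :: .state ⟨default, hM.1⟩ :: p.map .sym) [.right] (.sym x)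
  refine hn (ComputablePred.computable_of_manyOneReducible ⟨G, hG, fun n => ?_⟩ h)
  refine (Turing.TM0.eval_dom_iff_semiThue hM _).trans (Iff.trans ?_ (hsq n).symm)
  simp [Turing.TM0.configWord]
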